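/- In Permutation-Mastermind (Black-Peg Mastermind with $n$ holes and $k=n$ colours, no repetition of colours) the codemaker chooses a secret permutation $y\in S_n$. The codebreaker adaptively queries permutations $x\in S_n$, and each query is answered by $\mathrm{black}(x,y)=|\{i\in\{1,\dots,n\}: x(i)=y(i)\}|$. Let $\sigma^1$ be the identity $(1,2,\dots,n)$ and let $\sigma^{j+1}$ arise from $\sigma^j$ by a circular shift to the right. There is a single deterministic polynomial-time algorithm for the codebreaker (one program and one polynomial $T$, for all $n$) such that the following holds for every $n\ge 1$ and every secret $y\in S_n$. Given $n$, and given access to $y$ only through the answers to its queries, the algorithm halts after at most $T(n)$ steps, all its queries are permutations, its first $n-1$ queries are $\sigma^1,\dots,\sigma^{n-1}$, its last query is $y$ and it outputs $y$. The total number of its queries, including the last one, is at most $$(n-3)\lceil\log_2 n\rceil+\tfrac52 n-1 .$$ -/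

import Mathlib

namespace Mastermind

/-- The answer of the codemaker in the Black-Peg game: the number of positions in which the two
codes coincide. Positions and colours are both numbered by `Fin n`, and codes are permutations. -/
def black {n : ℕ} (x y : Equiv.Perm (Fin n)) : ℕ :=
  (Finset.univ.filter fun i : Fin n => x i = y i).card

/-- The identity shifted `j` times circularly to the right, in one-line notation; for `n = 4`
these are `(0,1,2,3)`, `(3,0,1,2)`, `(2,3,0,1)`, `(1,2,3,0)`. -/
def cyclicShift (n j : ℕ) : Equiv.Perm (Fin n) :=
  (finRotate n)⁻¹ ^ j

/-- The memory of the codebreaker's machine: registers, and arrays, holding natural numbers. -/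
structure Memory where
  /-- the content of the register with the given name -/
  reg : ℕ → ℕ
  /-- `arr k i` is the entry with index `i` of the array with name `k` -/
  arr : ℕ → ℕ → ℕ

/-- At the start register `0` holds the number `n` of holes; everything else is zero. -/
def Memory.init (n : ℕ) : Memory where
  reg := fun k => if k = 0 then n else 0
  arr := fun _ _ => 0

/-- Writing `v` into register `k`. -/
def Memory.setReg (M : Memory) (k v : ℕ) : Memory where
  reg := Function.update M.reg k v
  arr := M.arr

/-- Writing `v` into the entry `i` of array `k`. -/
def Memory.setArr (M : Memory) (k i v : ℕ) : Memory where
  reg := M.reg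
  arr := Function.update M.arr k (Function.update (M.arr k) i v)

/-- Arithmetic expressions. There is no multiplication, so one operation lengthens the binary
representation of the numbers involved by at most one bit: up to a polynomial, the number of
elementary operations is the running time of a Turing machine. -/
inductive Expr where
  /-- a constant -/
  | lit (c : ℕ)
  /-- the content of register `k` -/
  | reg (k : ℕ)
  /-- the entry of array `k` at the index given by an expression -/
  | arr (k : ℕ) (i : Expr)
  /-- addition -/
  | add (e f : Expr)
  /-- subtraction, truncated at zero -/
  | sub (e f : Expr)
  /-- the integer part of one half -/
  | half (e : Expr)

/-- The value of an expression. -/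
def Expr.eval (M : Memory) : Expr → ℕ
  | .lit c => c
  | .reg k => M.reg k
  | .arr k i => M.arr k (i.eval M)
  | .add e f => e.eval M + f.eval M
  | .sub e f => e.eval M - f.eval M
  | .half e => e.eval M / 2

/-- The number of elementary operations in the evaluation of an expression. -/
def Expr.cost : Expr → ℕ
  | .lit _ => 1
  | .reg _ => 1
  | .arr _ i => i.cost + 1
  | .add e f => e.cost + f.cost + 1
  | .sub e f => e.cost + f.cost + 1
  | .half e => e.cost + 1

/-- Programs for the codebreaker. A program is a finite piece of syntax; it does not depend on
the number of holes or on the secret code. -/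
inductive Program where
  /-- do nothing -/
  | skip
  /-- write the value of an expression into register `k` -/
  | setReg (k : ℕ) (e : Expr)
  /-- write the value of `e` into array `k`, at the index given by `i` -/
  | setArr (k : ℕ) (i e : Expr)
  /-- first `p`, then `q` -/
  | seq (p q : Program)
  /-- `p` if the value of `e` is nonzero, otherwise `q` -/
  | ite (e : Expr) (p q : Program)
  /-- repeat `p` as long as the value of `e` is nonzero -/
  | loop (e : Expr) (p : Program)
  /-- guess the code in the entries `0, …, n - 1` of array `k`; put the answer into register `d` -/
  | query (k d : ℕ)

/-- `Run y p M M' t qs`: started with memory `M`, and with the codemaker answering according to the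
secret code `y`, the program `p` halts with memory `M'` after `t` steps, and `qs` is the list of
the codes it has guessed, in this order. A guess that is not a permutation is illegal: it has no
run. The secret is used for the answers to the guesses only. -/
inductive Run {n : ℕ} (y : Equiv.Perm (Fin n)) :
    Program → Memory → Memory → ℕ → List (Equiv.Perm (Fin n)) → Prop where
  | skip (M : Memory) : Run y .skip M M 1 []
  | setReg (M : Memory) (k : ℕ) (e : Expr) :
      Run y (.setReg k e) M (M.setReg k (e.eval M)) (e.cost + 1) []
  | setArr (M : Memory) (k : ℕ) (i e : Expr) :
      Run y (.setArr k i e) M (M.setArr k (i.eval M) (e.eval M)) (i.cost + e.cost + 1) []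
  | seq {p q : Program} {M₀ M₁ M₂ : Memory} {t₁ t₂ : ℕ} {qs₁ qs₂ : List (Equiv.Perm (Fin n))}
      (h₁ : Run y p M₀ M₁ t₁ qs₁) (h₂ : Run y q M₁ M₂ t₂ qs₂) :
      Run y (.seq p q) M₀ M₂ (t₁ + t₂) (qs₁ ++ qs₂)
  | iteTrue {e : Expr} {p q : Program} {M M' : Memory} {t : ℕ} {qs : List (Equiv.Perm (Fin n))}
      (he : e.eval M ≠ 0) (h : Run y p M M' t qs) :
      Run y (.ite e p q) M M' (e.cost + 1 + t) qs
  | iteFalse {e : Expr} {p q : Program} {M M' : Memory} {t : ℕ} {qs : List (Equiv.Perm (Fin n))}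
      (he : e.eval M = 0) (h : Run y q M M' t qs) :
      Run y (.ite e p q) M M' (e.cost + 1 + t) qs
  | loopDone {e : Expr} {p : Program} {M : Memory} (he : e.eval M = 0) :
      Run y (.loop e p) M M (e.cost + 1) []
  | loopStep {e : Expr} {p : Program} {M₀ M₁ M₂ : Memory} {t₁ t₂ : ℕ}
      {qs₁ qs₂ : List (Equiv.Perm (Fin n))} (he : e.eval M₀ ≠ 0)
      (h₁ : Run y p M₀ M₁ t₁ qs₁) (h₂ : Run y (.loop e p) M₁ M₂ t₂ qs₂) :
      Run y (.loop e p) M₀ M₂ (e.cost + 1 + t₁ + t₂) (qs₁ ++ qs₂)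
  | query (M : Memory) (k d : ℕ) (x : Equiv.Perm (Fin n))
      (hx : ∀ i : Fin n, M.arr k (i : ℕ) = (x i : ℕ)) :
      Run y (.query k d) M (M.setReg d (black x y)) (n + 1) [x]

/-- A program is deterministic: the secret code determines the guesses, the number of steps and
the final memory. -/
theorem Run.deterministic {n : ℕ} {y : Equiv.Perm (Fin n)} {p : Program} {M M₁ M₂ : Memory}
    {t₁ t₂ : ℕ} {qs₁ qs₂ : List (Equiv.Perm (Fin n))} (h₁ : Run y p M M₁ t₁ qs₁)
    (h₂ : Run y p M M₂ t₂ qs₂) : M₁ = M₂ ∧ t₁ = t₂ ∧ qs₁ = qs₂ := by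
  induction h₁ generalizing M₂ t₂ qs₂ with
  | skip => cases h₂; simp
  | setReg => cases h₂; simp
  | setArr => cases h₂; simp
  | seq _ _ ih₁ ih₂ =>
    cases h₂ with
    | seq g₁ g₂ =>
      obtain ⟨rfl, rfl, rfl⟩ := ih₁ g₁
      obtain ⟨rfl, rfl, rfl⟩ := ih₂ g₂
      simp
  | iteTrue he _ ih =>
    cases h₂ with
    | iteTrue _ g => obtain ⟨rfl, rfl, rfl⟩ := ih g; simp
    | iteFalse he' _ => exact absurd he' he
  | iteFalse he _ ih =>
    cases h₂ with
    | iteFalse _ g => obtain ⟨rfl, rfl, rfl⟩ := ih g; simp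
    | iteTrue he' _ => exact absurd he he'
  | loopDone he =>
    cases h₂ with
    | loopDone _ => simp
    | loopStep he' _ _ => exact absurd he he'
  | loopStep he _ _ ih₁ ih₂ =>
    cases h₂ with
    | loopDone he' => exact absurd he' he
    | loopStep _ g₁ g₂ =>
      obtain ⟨rfl, rfl, rfl⟩ := ih₁ g₁
      obtain ⟨rfl, rfl, rfl⟩ := ih₂ g₂
      simp
  | query M k d x hx =>
    cases h₂ with
    | query _ _ _ x' hx' =>
      obtain rfl : x = x' := Equiv.ext fun i => Fin.ext ((hx i).symm.trans (hx' i))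
      simp

end Mastermind

/-!
The answer to the shift by `d` is the number of pegs of `y` on the diagonal `i - y i = d`, and the
last diagonal gets what the other ones leave over. If some peg is known, then not every diagonal has
an unknown peg, so some diagonal `d` that has one is cyclically followed by a diagonal without any.
Glue the shifts by `d` and by `d + 1` together, filling the position in between with a known colour:
the unknown pegs that are correct in such a hybrid are those on the diagonal `d` before this
position. So a binary search with at most `⌈log₂ (n - 1)⌉` hybrids finds one more peg, and the last
peg is determined by its diagonal.

The first peg costs at most `n - 1` queries. If some diagonal is empty, ask for all hybrids that are
filled with the colour `0`: the answers drop exactly when its position is passed. Otherwise every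
diagonal has exactly one peg, so the identity is correct in a single position, and exchanging two
colours in it gives the answer `0` if and only if one of them is in this position. Altogether, there
are at most `2 (n - 1) + (n - 2) ⌈log₂ (n - 1)⌉ + 1` queries.
-/

namespace Mastermind

section Codes

variable {n : ℕ} (y : Equiv.Perm (Fin n)) {S : Finset (Fin n)}

/-- The diagonal of the peg of `y` at position `i`: the number of circular shifts that bring its
colour to this position. -/
def diag (i : Fin n) : Fin n := i - y i

/-- The number of positions outside `S` whose pegs lie on the diagonal `d`. In the algorithm `S` is
the set of the positions whose pegs are known. -/
def diagCount (S : Finset (Fin n)) (d : Fin n) : ℕ :=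
  (Finset.univ.filter fun i : Fin n => i ∉ S ∧ diag y i = d).card

theorem diagCount_ne_zero_iff {d : Fin n} : diagCount y S d ≠ 0 ↔ ∃ i ∉ S, diag y i = d := by
  simp [diagCount]

theorem diagCount_eq_zero_iff {d : Fin n} : diagCount y S d = 0 ↔ ∀ i ∉ S, diag y i ≠ d := by
  simp [diagCount, Finset.filter_eq_empty_iff]

theorem diagCount_insert {i : Fin n} (hi : i ∉ S) (d : Fin n) :
    diagCount y (insert i S) d = if d = diag y i then diagCount y S d - 1 else diagCount y S d := by
  have herase : (Finset.univ.filter fun j => j ∉ insert i S ∧ diag y j = d) =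
      (Finset.univ.filter fun j => j ∉ S ∧ diag y j = d).erase i := by
    ext j
    simp only [Finset.mem_filter_univ, Finset.mem_insert, Finset.mem_erase]
    tauto
  rw [diagCount, herase, Finset.card_erase_eq_ite]
  simp [diagCount, hi, eq_comm]

theorem sum_filter_le_val {R : Type*} [AddCommMonoid R] (f : Fin n → R) (j : Fin n) :
    ∑ d ∈ Finset.univ.filter fun d : Fin n => (j : ℕ) ≤ d, f d =
      f j + ∑ d ∈ Finset.univ.filter fun d : Fin n => j + 1 ≤ (d : ℕ), f d := by
  rw [← Finset.sum_insert (by simp)]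
  congr 1
  ext d
  simp only [Finset.mem_filter, Finset.mem_univ, true_and, Finset.mem_insert, Fin.ext_iff]
  omega

theorem sum_diagCount : ∑ d, diagCount y S d = Sᶜ.card := by
  rw [Finset.card_eq_sum_card_fiberwise (s := Sᶜ) fun i _ => Finset.mem_univ (diag y i)]
  refine Finset.sum_congr rfl fun d _ => congrArg Finset.card ?_
  ext i
  simp

theorem exists_diagCount_eq_zero (hS : S.Nonempty) : ∃ d, diagCount y S d = 0 := by
  by_contra! h
  have hle : ∑ _d : Fin n, 1 ≤ ∑ d, diagCount y S d :=
    Finset.sum_le_sum fun d _ => Nat.one_le_iff_ne_zero.2 (h d)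
  have hpos := hS.card_pos
  have hcard := S.card_add_card_compl
  simp only [sum_diagCount, Finset.sum_const, Finset.card_univ, smul_eq_mul, mul_one,
    Fintype.card_fin] at hle hcard
  omega

theorem diagCount_empty_eq_one (h : ∀ d, diagCount y ∅ d ≠ 0) (d : Fin n) :
    diagCount y ∅ d = 1 := by
  have hle : ∀ d ∈ Finset.univ, 1 ≤ diagCount y ∅ d := fun d _ => Nat.one_le_iff_ne_zero.2 (h d)
  exact ((Finset.sum_eq_sum_iff_of_le hle).1 (by simp [sum_diagCount]) d
    (Finset.mem_univ d)).symm

/-- The number of known pegs that are correct in the guess `x`. -/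
def knownBlack (x : Equiv.Perm (Fin n)) (S : Finset (Fin n)) : ℕ :=
  (S.filter fun i => x i = y i).card

theorem knownBlack_lt_black_iff {x : Equiv.Perm (Fin n)} :
    knownBlack y x S < black x y ↔ ∃ i ∉ S, x i = y i := by
  have hsub : S.filter (fun i => x i = y i) ⊆ Finset.univ.filter fun i => x i = y i :=
    Finset.filter_subset_filter _ (Finset.subset_univ _)
  constructor
  · intro h
    obtain ⟨i, hi, hiS⟩ := Finset.exists_mem_notMem_of_card_lt_card h
    simp only [Finset.mem_filter, Finset.mem_univ, true_and, not_and] at hi hiS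
    exact ⟨i, fun hmem => hiS hmem hi, hi⟩
  · rintro ⟨i, hiS, hi⟩
    exact Finset.card_lt_card (Finset.ssubset_iff_of_subset hsub |>.2 ⟨i, by simpa, by simp [hiS]⟩)

variable [NeZero n] {d q m : Fin n}

theorem diag_eq_iff {i : Fin n} : diag y i = d ↔ y i = i - d := by
  rw [diag, sub_eq_iff_eq_add, eq_sub_iff_add_eq', eq_comm]

theorem cyclicShift_apply (j i : Fin n) : cyclicShift n j i = i - j := by
  rw [cyclicShift, inv_pow, Equiv.Perm.inv_eq_iff_eq, ← Equiv.Perm.iterate_eq_pow,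
    ← finCycle_eq_finRotate_iterate, finCycle_apply, sub_add_cancel]

theorem black_cyclicShift (d : Fin n) : black (cyclicShift n d) y = diagCount y ∅ d := by
  simp only [black, diagCount, cyclicShift_apply, diag_eq_iff, Finset.notMem_empty,
    not_false_eq_true, true_and, eq_comm (b := y _)]

open Fin.CommRing in
theorem exists_and_not_add_one {P : Fin n → Prop} (hP : ∃ a, P a) (hnot : ∃ b, ¬P b) :
    ∃ d, P d ∧ ¬P (d + 1) := by
  obtain ⟨a, ha⟩ := hP
  obtain ⟨b, hb⟩ := hnot
  by_contra! hstep
  have hadd (k : ℕ) : P (a + k) := by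
    induction k with
    | zero => simpa using ha
    | succ k ih => simpa [add_assoc] using hstep _ ih
  exact hb (by simpa using hadd (b - a : Fin n).val)

/-- Some unknown peg lies on the diagonal `d`, but none on the next one: the guesses `hybrid d` can
be used to find one. -/
def Gap (S : Finset (Fin n)) (d : Fin n) : Prop :=
  diagCount y S d ≠ 0 ∧ diagCount y S (d + 1) = 0

theorem exists_gap (hS : ∃ i, i ∉ S) (hzero : ∃ d, diagCount y S d = 0) : ∃ d, Gap y S d := by
  obtain ⟨i, hi⟩ := hS
  simpa [Gap] using exists_and_not_add_one (P := fun d => diagCount y S d ≠ 0)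
    ⟨diag y i, (diagCount_ne_zero_iff y).2 ⟨i, hi, rfl⟩⟩ (by simpa using hzero)

theorem Gap.diag_eq (h : Gap y S d) (hS : Sᶜ.card ≤ 1) {i : Fin n} (hi : i ∉ S) :
    diag y i = d := by
  obtain ⟨j, hj, hdj⟩ := (diagCount_ne_zero_iff y).1 h.1
  rw [← hdj, Finset.card_le_one.1 hS i (by simpa) j (by simpa)]

/-- The offset of the position `i`, counted from the position `q + d + 1` in which the shift by
`d + 1` has the colour `q`. -/
def offset (d q i : Fin n) : Fin n := i - (q + d + 1)

theorem add_offset (d q i : Fin n) : q + d + 1 + offset d q i = i :=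
  add_sub_cancel _ _

theorem offset_eq_iff {i : Fin n} : offset d q i = m ↔ i = q + d + 1 + m := by
  rw [offset, sub_eq_iff_eq_add']

/-- The guess that agrees with the shift by `d` up to the offset `m` and with the shift by `d + 1`
beyond it; at the offset `m` it has the remaining colour `q`. -/
def hybrid (d q m : Fin n) : Equiv.Perm (Fin n) :=
  (Equiv.subRight (q + d + 1)).trans (m.cycleRange.trans (Equiv.addLeft q))

theorem hybrid_apply (i : Fin n) : hybrid d q m i =
    if offset d q i < m then i - d else if offset d q i = m then q else i - (d + 1) := by
  change q + m.cycleRange (offset d q i) = _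
  rw [Fin.cycleRange_apply]
  split_ifs <;> first | rw [offset]; abel | rw [add_zero]

theorem hybrid_apply_eq_iff {i : Fin n} : hybrid d q m i = y i ↔
    (offset d q i < m ∧ diag y i = d) ∨ (m < offset d q i ∧ diag y i = d + 1) ∨
      (offset d q i = m ∧ y i = q) := by
  rw [hybrid_apply, diag_eq_iff, diag_eq_iff]
  rcases lt_trichotomy (offset d q i) m with h | h | h
  · simp [h, h.ne, h.not_gt, eq_comm]
  · simp [h, eq_comm]
  · simp [h, h.ne', h.not_gt, eq_comm]

theorem hybrid_apply_add (t : Fin n) : hybrid d q m (q + d + 1 + t) =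
    if t < m then q + 1 + t else if t = m then q else q + t := by
  rw [hybrid_apply, offset, add_sub_cancel_left]
  congr 2 <;> abel

theorem hybrid_last_eq_cyclicShift (hm : (m : ℕ) + 1 = n) : hybrid d 0 m = cyclicShift n d := by
  have hle (k : Fin n) : k ≤ m := Fin.le_def.2 (by omega)
  have hm' : m + 1 = 0 := Fin.ext (by simp [Fin.val_add, hm])
  ext i : 1
  rw [hybrid_apply, cyclicShift_apply]
  split_ifs with hlt heq
  · rfl
  · rw [(offset_eq_iff).1 heq, eq_comm, sub_eq_zero, zero_add, add_assoc, add_comm 1, hm', add_zero]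
  · exact absurd (lt_of_le_of_ne (hle _) heq) hlt

theorem diag_of_apply_eq {i : Fin n} (h : y i = q) : diag y i = d + 1 + offset d q i := by
  rw [diag, offset, h]
  abel

theorem black_hybrid_zero (h : diagCount y ∅ (d + 1) = 0) : black (hybrid d q 0) y = 0 := by
  have hdiag : ∀ i, diag y i ≠ d + 1 := by simpa using (diagCount_eq_zero_iff y).1 h
  rw [black, Finset.card_eq_zero, Finset.filter_eq_empty_iff]
  intro i _
  rw [hybrid_apply_eq_iff]
  rintro (⟨h, -⟩ | ⟨-, h⟩ | ⟨h, hq⟩)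
  · exact absurd h (Fin.not_lt_zero _)
  · exact hdiag i h
  · exact hdiag i (by rw [diag_of_apply_eq y hq, h, add_zero])

theorem black_hybrid_succ_lt_iff (h : diagCount y ∅ (d + 1) = 0) {m' : Fin n}
    (hm' : (m' : ℕ) = m + 1) :
    black (hybrid d q m') y < black (hybrid d q m) y ↔ offset d q (y.symm q) = m := by
  have hdiag : ∀ i, diag y i ≠ d + 1 := by simpa using (diagCount_eq_zero_iff y).1 h
  have hlt {k : Fin n} : k < m' ↔ k < m ∨ k = m := by
    simp only [Fin.lt_def, Fin.ext_iff, hm']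
    omega
  have hq {i : Fin n} : y i = q ↔ i = y.symm q := by rw [Equiv.eq_symm_apply]
  simp only [black, hybrid_apply_eq_iff, hdiag, and_false, false_or]
  constructor
  · intro hcard
    obtain ⟨i, hi, hi'⟩ := Finset.exists_mem_notMem_of_card_lt_card hcard
    simp only [Finset.mem_filter_univ, hlt] at hi hi'
    obtain hi | ⟨hi, rfl⟩ := hi
    · exact absurd (Or.inl ⟨Or.inl hi.1, hi.2⟩) hi'
    · simpa using hi
  · intro hm
    refine Finset.card_lt_card (Finset.ssubset_iff_of_subset (fun i hi => ?_) |>.2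
      ⟨y.symm q, by simp [hm], ?_⟩)
    · simp only [Finset.mem_filter_univ, hlt] at hi ⊢
      obtain ⟨hi | hi, hdi⟩ | ⟨hi, rfl⟩ := hi
      · exact Or.inl ⟨hi, hdi⟩
      · refine Or.inr ⟨hi, ?_⟩
        rw [offset_eq_iff] at hm hi
        rw [hi, ← hm, Equiv.apply_symm_apply]
      · exact Or.inr ⟨by simpa using hm, rfl⟩
    · have hsucc : m' = m + 1 := Fin.ext (by rw [Fin.val_add_one_of_lt' (by omega), hm'])
      have hne : m ≠ m' := by rintro rfl; omega
      have h0 : m' ≠ 0 := by rintro rfl; simp at hm'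
      have hdq : diag y (y.symm q) = d + m' := by
        rw [diag_of_apply_eq (d := d) y (y.apply_symm_apply q), hm, hsucc, add_assoc, add_comm 1 m]
      simp [hm, hdq, hne, h0]

theorem black_swap_eq_zero_iff (h : diagCount y ∅ 0 = 1) {e k l : Fin n} (he : y e = e)
    (hkl : k ≠ l) : black (Equiv.swap k l) y = 0 ↔ e = k ∨ e = l := by
  have huniq {i : Fin n} (hi : y i = i) : i = e := by
    refine Finset.card_le_one.1 h.le i ?_ e ?_ <;> simp [diag_eq_iff, hi, he]
  have hmove : e = k ∨ e = l ↔ Equiv.swap k l e ≠ e := by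
    simp [Equiv.swap_apply_ne_self_iff, hkl]
  rw [hmove, black, Finset.card_eq_zero, Finset.filter_eq_empty_iff]
  refine ⟨fun hne heq => hne (Finset.mem_univ e) (heq.trans he.symm), fun hne i _ hi => ?_⟩
  by_cases hfix : Equiv.swap k l i = i
  · exact hne (huniq (hi.symm.trans hfix) ▸ hfix)
  · obtain ⟨-, rfl | rfl⟩ := Equiv.swap_apply_ne_self_iff.1 hfix <;>
      obtain rfl | rfl := hmove.2 hne <;> simp_all

theorem knownBlack_lt_black_hybrid_iff {p : Fin n} (hp : p ∈ S)
    (h : diagCount y S (d + 1) = 0) :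
    knownBlack y (hybrid d (y p) m) S < black (hybrid d (y p) m) y ↔
      ∃ i ∉ S, diag y i = d ∧ offset d (y p) i < m := by
  rw [knownBlack_lt_black_iff]
  refine exists_congr fun i => and_congr_right fun hi => ?_
  have hne : y i ≠ y p := fun h => hi (y.injective h ▸ hp)
  simp [hybrid_apply_eq_iff, (diagCount_eq_zero_iff y).1 h i hi, hne, and_comm]

theorem apply_of_diag_eq {i : Fin n} (h : diag y i = d) : y i = q + offset d q i + 1 := by
  rw [(diag_eq_iff y).1 h, offset]
  abel

theorem offset_add_one_lt {p i : Fin n} (hp : p ∈ S) (hi : i ∉ S) (h : diag y i = d) :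
    (offset d (y p) i : ℕ) + 1 < n := by
  refine lt_of_le_of_ne (offset d (y p) i).2 fun hlast => hi ?_
  have hzero : offset d (y p) i + 1 = 0 := Fin.ext (by simp [Fin.val_add, hlast])
  have happly : y i = y p := by
    rw [apply_of_diag_eq y (q := y p) h, add_assoc, hzero, add_zero]
  exact y.injective happly ▸ hp

/-- This makes the binary search possible: the answer to `hybrid d (y p) m` tells whether `m` is
beyond the offset of a certain unknown peg. -/
theorem Gap.exists_knownBlack_lt_black_iff {p : Fin n} (hp : p ∈ S) (h : Gap y S d) :
    ∃ i ∉ S, diag y i = d ∧ ∀ m : Fin n,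
      knownBlack y (hybrid d (y p) m) S < black (hybrid d (y p) m) y ↔ offset d (y p) i < m := by
  obtain ⟨i, hi, hmin⟩ := Finset.exists_min_image
    (Finset.univ.filter fun i => i ∉ S ∧ diag y i = d) (offset d (y p)) (Finset.card_ne_zero.1 h.1)
  simp only [Finset.mem_filter_univ] at hi hmin
  refine ⟨i, hi.1, hi.2, fun m => (knownBlack_lt_black_hybrid_iff y hp h.2).trans
    ⟨fun ⟨j, hj, hdj, hlt⟩ => (hmin j ⟨hj, hdj⟩).trans_lt hlt, fun hlt => ⟨i, hi.1, hi.2, hlt⟩⟩⟩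

end Codes

theorem Memory.setReg_reg (M : Memory) (k v l : ℕ) :
    (M.setReg k v).reg l = if l = k then v else M.reg l :=
  Function.update_apply ..

theorem Memory.setReg_arr (M : Memory) (k v : ℕ) : (M.setReg k v).arr = M.arr := rfl

theorem Memory.setArr_reg (M : Memory) (k i v : ℕ) : (M.setArr k i v).reg = M.reg := rfl

theorem Memory.setArr_arr (M : Memory) (k i v l j : ℕ) :
    (M.setArr k i v).arr l j = if l = k ∧ j = i then v else M.arr l j := by
  simp only [Memory.setArr, Function.update_apply]
  grind

namespace Program

/-- A bound for the running time, in terms of the number of holes, that is valid if the number of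
rounds of every loop is at most the number of holes. -/
noncomputable def time : Program → Polynomial ℕ
  | skip => 1
  | setReg _ e => (e.cost + 1 : ℕ)
  | setArr _ i e => (i.cost + e.cost + 1 : ℕ)
  | seq p q => p.time + q.time
  | ite e p q => ((e.cost + 1 : ℕ) : Polynomial ℕ) + p.time + q.time
  | loop e p => (Polynomial.X + 1) * (((e.cost + 1 : ℕ) : Polynomial ℕ) + p.time)
  | query _ _ => Polynomial.X + 1

/-- The registers that a program may change. -/
def writtenRegs : Program → List ℕ
  | skip => []
  | setReg k _ => [k]
  | setArr _ _ _ => []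
  | seq p q => p.writtenRegs ++ q.writtenRegs
  | ite _ p q => p.writtenRegs ++ q.writtenRegs
  | loop _ p => p.writtenRegs
  | query _ d => [d]

/-- The arrays that a program may change. -/
def writtenArrs : Program → List ℕ
  | skip => []
  | setReg _ _ => []
  | setArr k _ _ => [k]
  | seq p q => p.writtenArrs ++ q.writtenArrs
  | ite _ p q => p.writtenArrs ++ q.writtenArrs
  | loop _ p => p.writtenArrs
  | query _ _ => []

end Program

/-- The memories `M` and `M'` agree except where the program `p` may write. -/
structure Preserves (p : Program) (M M' : Memory) : Prop where
  reg_eq (k : ℕ) (hk : k ∉ p.writtenRegs := by decide) : M'.reg k = M.reg k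
  arr_eq (k : ℕ) (hk : k ∉ p.writtenArrs := by decide) : M'.arr k = M.arr k

theorem Preserves.refl (p : Program) (M : Memory) : Preserves p M M :=
  ⟨fun _ _ => rfl, fun _ _ => rfl⟩

theorem Preserves.trans {p : Program} {M₁ M₂ M₃ : Memory} (h₁ : Preserves p M₁ M₂)
    (h₂ : Preserves p M₂ M₃) : Preserves p M₁ M₃ :=
  ⟨fun k hk => (h₂.reg_eq k hk).trans (h₁.reg_eq k hk),
    fun k hk => (h₂.arr_eq k hk).trans (h₁.arr_eq k hk)⟩

theorem Preserves.mono {p q : Program} {M M' : Memory} (h : Preserves p M M')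
    (hr : p.writtenRegs ⊆ q.writtenRegs) (ha : p.writtenArrs ⊆ q.writtenArrs) :
    Preserves q M M' :=
  ⟨fun k hk => h.reg_eq k fun hk' => hk (hr hk'), fun k hk => h.arr_eq k fun hk' => hk (ha hk')⟩

section Logic

variable {n : ℕ}

/-- Postconditions: properties of the final memory and of the list of the guesses made. -/
abbrev Post (n : ℕ) := Memory → List (Equiv.Perm (Fin n)) → Prop

/-- The weakest precondition of a loop with at most `k` rounds, where `W` is that of its body. -/
def EnsuresLoop (W : Memory → Post n → Prop) (e : Expr) : ℕ → Memory → Post n → Prop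
  | 0, M, Q => e.eval M = 0 ∧ Q M []
  | k + 1, M, Q => if e.eval M = 0 then Q M [] else
      W M fun M' qs => EnsuresLoop W e k M' fun M'' qs' => Q M'' (qs ++ qs')

/-- The weakest precondition: started with memory `M` against the secret `y`, the program `p` halts
with `Q`, every loop having at most `n` rounds. -/
def Ensures (y : Equiv.Perm (Fin n)) : Program → Memory → Post n → Prop
  | .skip, M, Q => Q M []
  | .setReg k e, M, Q => Q (M.setReg k (e.eval M)) []
  | .setArr k i e, M, Q => Q (M.setArr k (i.eval M) (e.eval M)) []
  | .seq p q, M, Q => Ensures y p M fun M' qs => Ensures y q M' fun M'' qs' => Q M'' (qs ++ qs')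
  | .ite e p q, M, Q => if e.eval M = 0 then Ensures y q M Q else Ensures y p M Q
  | .loop e p, M, Q => EnsuresLoop (Ensures y p) e n M Q
  | .query k d, M, Q =>
      ∃ x : Equiv.Perm (Fin n), (∀ i : Fin n, M.arr k i = x i) ∧ Q (M.setReg d (black x y)) [x]

variable {y : Equiv.Perm (Fin n)} {p q : Program} {e : Expr} {M : Memory} {Q R : Post n}

theorem EnsuresLoop.exists_run {k : ℕ} (hp : ∀ {M : Memory} {Q : Post n}, Ensures y p M Q →
      ∃ M' t qs, Run y p M M' t qs ∧ t ≤ p.time.eval n ∧ Q M' qs)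
    (h : EnsuresLoop (Ensures y p) e k M Q) : ∃ M' t qs, Run y (.loop e p) M M' t qs ∧
      t ≤ k * (e.cost + 1 + p.time.eval n) + (e.cost + 1) ∧ Q M' qs := by
  induction k generalizing M Q with
  | zero => exact ⟨M, _, _, .loopDone h.1, by simp, h.2⟩
  | succ k ih =>
    rw [EnsuresLoop] at h
    split_ifs at h with he
    · exact ⟨M, _, _, .loopDone he, by simp, h⟩
    · obtain ⟨M₁, t₁, qs₁, hrun₁, ht₁, h₁⟩ := hp h
      obtain ⟨M₂, t₂, qs₂, hrun₂, ht₂, h₂⟩ := ih h₁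
      refine ⟨M₂, _, _, .loopStep he hrun₁ hrun₂, ?_, h₂⟩
      rw [Nat.add_one_mul]
      omega

theorem Ensures.exists_run (h : Ensures y p M Q) :
    ∃ M' t qs, Run y p M M' t qs ∧ t ≤ p.time.eval n ∧ Q M' qs := by
  induction p generalizing M Q with
  | skip => exact ⟨_, _, _, .skip M, by simp [Program.time], h⟩
  | setReg k e => exact ⟨_, _, _, .setReg M k e, by simp [Program.time], h⟩
  | setArr k i e => exact ⟨_, _, _, .setArr M k i e, by simp [Program.time], h⟩
  | seq p q ihp ihq =>
    obtain ⟨M₁, t₁, qs₁, hrun₁, ht₁, h₁⟩ := ihp h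
    obtain ⟨M₂, t₂, qs₂, hrun₂, ht₂, h₂⟩ := ihq h₁
    exact ⟨M₂, _, _, .seq hrun₁ hrun₂, by simpa [Program.time] using add_le_add ht₁ ht₂, h₂⟩
  | ite e p q ihp ihq =>
    rw [Ensures] at h
    split_ifs at h with he
    · obtain ⟨M', t, qs, hrun, ht, h'⟩ := ihq h
      refine ⟨M', _, qs, .iteFalse he hrun, ?_, h'⟩
      simp [Program.time]
      omega
    · obtain ⟨M', t, qs, hrun, ht, h'⟩ := ihp h
      refine ⟨M', _, qs, .iteTrue he hrun, ?_, h'⟩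
      simp [Program.time]
      omega
  | loop e p ih =>
    obtain ⟨M', t, qs, hrun, ht, h'⟩ := EnsuresLoop.exists_run ih h
    refine ⟨M', t, qs, hrun, ht.trans ?_, h'⟩
    simp [Program.time]
    linarith
  | query k d =>
    obtain ⟨x, hx, h⟩ := h
    exact ⟨_, _, _, .query M k d x hx, by simp [Program.time], h⟩

theorem EnsuresLoop.mono {k : ℕ} {W : Memory → Post n → Prop}
    (hW : ∀ {M : Memory} {Q R : Post n}, W M Q →
      (∀ M' qs, Preserves p M M' → Q M' qs → R M' qs) → W M R)
    (h : EnsuresLoop W e k M Q) (hQR : ∀ M' qs, Preserves p M M' → Q M' qs → R M' qs) :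
    EnsuresLoop W e k M R := by
  induction k generalizing M Q R with
  | zero => exact ⟨h.1, hQR M [] (.refl p M) h.2⟩
  | succ k ih =>
    rw [EnsuresLoop] at h ⊢
    split_ifs at h ⊢
    · exact hQR M [] (.refl p M) h
    · exact hW h fun M₁ qs₁ h₁ hl => ih hl fun M₂ qs₂ h₂ => hQR M₂ _ (h₁.trans h₂)

theorem Ensures.mono (h : Ensures y p M Q)
    (hQR : ∀ M' qs, Preserves p M M' → Q M' qs → R M' qs) : Ensures y p M R := by
  induction p generalizing M Q R with
  | skip => exact hQR _ _ (.refl _ M) h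
  | setReg k e =>
    exact hQR _ _ ⟨fun l hl => by simp_all [Program.writtenRegs, Memory.setReg_reg],
      fun _ _ => rfl⟩ h
  | setArr k i e =>
    refine hQR _ _ ⟨fun _ _ => rfl, fun l hl => funext fun j => ?_⟩ h
    simp_all [Program.writtenArrs, Memory.setArr_arr]
  | seq p q ihp ihq =>
    exact ihp h fun M₁ qs₁ h₁ hq => ihq hq fun M₂ qs₂ h₂ => hQR M₂ _
      ((h₁.mono (List.subset_append_left _ _) (List.subset_append_left _ _)).trans
        (h₂.mono (List.subset_append_right _ _) (List.subset_append_right _ _)))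
  | ite e p q ihp ihq =>
    rw [Ensures] at h ⊢
    split_ifs at h ⊢
    · exact ihq h fun M' qs h' =>
        hQR M' qs (h'.mono (List.subset_append_right _ _) (List.subset_append_right _ _))
    · exact ihp h fun M' qs h' =>
        hQR M' qs (h'.mono (List.subset_append_left _ _) (List.subset_append_left _ _))
  | loop e p ih =>
    exact EnsuresLoop.mono ih h fun M' qs h' =>
      hQR M' qs (h'.mono (List.Subset.refl _) (List.Subset.refl _))
  | query k d =>
    obtain ⟨x, hx, h⟩ := h
    exact ⟨x, hx, hQR _ _ ⟨fun l hl => by simp_all [Program.writtenRegs, Memory.setReg_reg],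
      fun _ _ => rfl⟩ h⟩

theorem ensures_loop (I : Post n) (μ : Memory → ℕ) (hμ : μ M ≤ n) (hinit : I M [])
    (hstep : ∀ M₁ qs, Preserves p M M₁ → I M₁ qs → e.eval M₁ ≠ 0 →
      Ensures y p M₁ fun M₂ qs' => I M₂ (qs ++ qs') ∧ μ M₂ < μ M₁)
    (hpost : ∀ M₁ qs, Preserves p M M₁ → I M₁ qs → e.eval M₁ = 0 → Q M₁ qs) :
    Ensures y (.loop e p) M Q := by
  have hfuel (k : ℕ) (M₁ : Memory) (qs : List (Equiv.Perm (Fin n))) (hM₁ : Preserves p M M₁)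
      (hI : I M₁ qs) (hk : μ M₁ ≤ k) :
      EnsuresLoop (Ensures y p) e k M₁ fun M₂ qs' => Q M₂ (qs ++ qs') := by
    induction k generalizing M₁ qs with
    | zero =>
      have he : e.eval M₁ = 0 := by
        by_contra he
        obtain ⟨M₂, _, _, _, _, _, hlt⟩ := (hstep M₁ qs hM₁ hI he).exists_run
        omega
      exact ⟨he, by simpa using hpost M₁ qs hM₁ hI he⟩
    | succ k ih =>
      rw [EnsuresLoop]
      split_ifs with he
      · simpa using hpost M₁ qs hM₁ hI he
      · refine (hstep M₁ qs hM₁ hI he).mono fun M₂ qs' hM₂ ⟨hI₂, hlt⟩ => ?_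
        simpa using ih M₂ _ (hM₁.trans hM₂) hI₂ (Nat.lt_succ_iff.1 (hlt.trans_le hk))
  exact hfuel n M [] (.refl p M) hinit hμ

end Logic

section Programs

infixl:65 " ∔ " => Expr.add

infixl:65 " ∸ " => Expr.sub

infixr:60 " ;; " => Program.seq

/-- Run `p` for the values `0, …, N - 1` of the register `k`, where `N` is the content of the
register `r`. -/
def forLoop (k r : ℕ) (p : Program) : Program :=
  .setReg k (.lit 0) ;; .loop (.reg r ∸ .reg k) (p ;; .setReg k (.reg k ∔ .lit 1))

namespace Reg

abbrev size : ℕ := 0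
abbrev last : ℕ := 1
abbrev answer : ℕ := 2
abbrev d : ℕ := 3
abbrev q : ℕ := 4
abbrev m : ℕ := 5
abbrev i : ℕ := 6
abbrev j : ℕ := 7
abbrev previous : ℕ := 8
abbrev zeros : ℕ := 9
abbrev hits : ℕ := 10
abbrev pos : ℕ := 11
abbrev col : ℕ := 12
abbrev lo : ℕ := 13
abbrev hi : ℕ := 14
abbrev unknown : ℕ := 15

end Reg

namespace Arr

abbrev peg : ℕ := 0
abbrev guess : ℕ := 1
abbrev count : ℕ := 2
abbrev known : ℕ := 3
abbrev residue : ℕ := 4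

end Arr

open Mastermind.Expr Program Reg Arr

/-- Tabulate the residues modulo the number of holes: expressions have no division. -/
def fillResidues : Program :=
  setReg last (reg size ∸ lit 1) ;;
  forLoop i size
    (setArr residue (reg i) (reg i) ;;
      setArr residue (reg size ∔ reg i) (reg i) ;;
      setArr residue (reg size ∔ reg size ∔ reg i) (reg i))

/-- The position with offset `t`, for the hybrids given by the registers `d` and `q`. -/
def positionAt (t : Expr) : Expr := arr residue (reg q ∔ reg d ∔ lit 1 ∔ t)

/-- Write the code `hybrid d q m` into the array `guess`. -/
def writeHybrid : Program :=
  forLoop i size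
    (ite (reg m ∸ reg i) (setArr guess (positionAt (reg i)) (arr residue (reg q ∔ lit 1 ∔ reg i)))
      (ite (reg i ∸ reg m) (setArr guess (positionAt (reg i)) (arr residue (reg q ∔ reg i)))
        (setArr guess (positionAt (reg i)) (reg q))))

/-- Guess the code `hybrid d q m`. -/
def ask : Program := writeHybrid ;; query guess answer

/-- Ask for the shifts in turn. The last diagonal count is what the other ones leave over. -/
def countShifts : Program :=
  setReg q (lit 0) ;;
  setReg m (reg last) ;;
  setReg unknown (reg size) ;;
  setArr count (reg last) (reg size) ;;
  forLoop d last
    (ask ;;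
      setArr count (reg d) (reg answer) ;;
      setArr count (reg last) (arr count (reg last) ∸ reg answer))

/-- Put a gap into the register `d`, or the number of holes if there is none. -/
def findGap : Program :=
  setReg d (reg size) ;;
  forLoop j size
    (ite (arr count (reg j))
      (ite (arr count (arr residue (reg j ∔ lit 1))) skip (setReg d (reg j))) skip)

/-- Record that the colour `col` is at the position `pos`. -/
def record : Program :=
  setReg j (arr residue (reg size ∔ reg pos ∸ reg col)) ;;
  setReg unknown (reg unknown ∸ lit 1) ;;
  setArr count (reg j) (arr count (reg j) ∸ lit 1) ;;
  setArr known (reg pos) (lit 1) ;;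
  setArr peg (reg pos) (reg col)

/-- Find the colour `0` by asking for all hybrids at the gap `d`. -/
def scanHybrids : Program :=
  setReg q (lit 0) ;;
  setReg previous (lit 0) ;;
  setReg lo (reg last) ;;
  forLoop j last
    (setReg m (reg j ∔ lit 1) ;;
      ask ;;
      ite (reg previous ∸ reg answer) (setReg lo (reg j)) skip ;;
      setReg previous (reg answer)) ;;
  setReg pos (positionAt (reg lo)) ;;
  setReg col (lit 0)

/-- Guess the identity with the colours `0` and `j + 1` exchanged. -/
def askSwap : Program :=
  writeHybrid ;;
  setArr guess (lit 0) (reg j ∔ lit 1) ;;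
  setArr guess (reg j ∔ lit 1) (lit 0) ;;
  query guess answer

/-- Find the only fixed point by exchanging `0` with the other colours in the identity: if it is
`0`, then all answers are `0`, and otherwise only one is. -/
def scanSwaps : Program :=
  setReg d (lit 0) ;;
  setReg q (lit 0) ;;
  setReg m (reg last) ;;
  setReg zeros (lit 0) ;;
  setReg pos (lit 0) ;;
  forLoop j last
    (askSwap ;;
      ite (reg answer) skip
        (setReg zeros (reg zeros ∔ lit 1) ;;
          setReg pos (reg j ∔ lit 1))) ;;
  ite (reg last ∸ reg zeros) skip (setReg pos (lit 0)) ;;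
  setReg col (reg pos)

/-- Find and record a first peg, and put its colour into the register `q`. -/
def findFirst : Program :=
  findGap ;;
  ite (reg size ∸ reg d) scanHybrids scanSwaps ;;
  setReg q (reg col) ;;
  record

/-- Count the known pegs that are correct in the last guess. -/
def tally : Program :=
  setReg hits (lit 0) ;;
  forLoop i size
    (ite (arr known (reg i))
      (ite ((arr peg (reg i) ∸ arr guess (reg i)) ∔ (arr guess (reg i) ∸ arr peg (reg i))) skip
        (setReg hits (reg hits ∔ lit 1))) skip)

/-- Guess `hybrid d q m` and count the known pegs that are correct in it. -/
def probe : Program := ask ;; tally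

/-- Locate the first unknown peg on the diagonal `d` between the offsets `lo` and `hi`. -/
def bisect : Program :=
  loop (reg hi ∸ reg lo ∸ lit 1)
    (setReg m (half (reg lo ∔ reg hi)) ;;
      probe ;;
      ite (reg answer ∸ reg hits) (setReg hi (reg m)) (setReg lo (reg m)))

/-- Find and record one more peg. -/
def findNext : Program :=
  findGap ;;
  setReg lo (lit 0) ;;
  setReg hi (reg last) ;;
  bisect ;;
  setReg pos (positionAt (reg lo)) ;;
  setReg col (arr residue (reg q ∔ reg lo ∔ lit 1)) ;;
  record

/-- Record pegs until at most one is unknown. -/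
def findRest : Program := loop (reg unknown ∸ lit 1) findNext

/-- Guess the secret: an unknown peg lies on the only diagonal that has one. -/
def finish : Program :=
  findGap ;;
  forLoop i size
    (ite (arr known (reg i)) skip
      (setArr peg (reg i) (arr residue (reg size ∔ reg i ∸ reg d)))) ;;
  query peg answer

/-- The strategy of the codebreaker. -/
def strategy : Program := fillResidues ;; countShifts ;; findFirst ;; findRest ;; finish

end Programs

theorem clog_two_add_one_le {w k : ℕ} (hw : 1 < w) (hk : k ≤ (w + 1) / 2) :
    Nat.clog 2 k + 1 ≤ Nat.clog 2 w := by
  rw [Nat.clog_of_two_le one_lt_two hw]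
  exact Nat.add_le_add_right (Nat.clog_mono_right 2 hk) 1

section Correctness

variable {n : ℕ} {y : Equiv.Perm (Fin n)} {p : Program} {M M' : Memory} {Q : Post n}

theorem ensures_forLoop {k r N : ℕ} (I : ℕ → Post n) (hr : M.reg r = N) (hN : N ≤ n)
    (hinit : I 0 M [])
    (hstep : ∀ j < N, ∀ M₁ qs, Preserves (forLoop k r p) M M₁ → M₁.reg k = j → I j M₁ qs →
      Ensures y p M₁ fun M₂ qs' => I (j + 1) M₂ (qs ++ qs'))
    (hpost : ∀ M₁ qs, Preserves (forLoop k r p) M M₁ → I N M₁ qs → Q M₁ qs)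
    (hI : ∀ {j M qs v}, I j M qs → I j (M.setReg k v) qs := by exact fun h => h)
    (hrk : r ≠ k := by decide) (hkp : k ∉ p.writtenRegs := by decide)
    (hrp : r ∉ p.writtenRegs := by decide) : Ensures y (forLoop k r p) M Q := by
  have hregs : (forLoop k r p).writtenRegs = k :: (p.writtenRegs ++ [k]) := rfl
  have hpres {M₁ : Memory} (h : Preserves (p ;; .setReg k (.reg k ∔ .lit 1)) (M.setReg k 0) M₁) :
      Preserves (forLoop k r p) M M₁ := by
    refine ⟨fun l hl => ?_, fun l hl => h.arr_eq l hl⟩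
    rw [hregs, List.mem_cons, not_or] at hl
    rw [h.reg_eq l hl.2, Memory.setReg_reg, if_neg hl.1]
  have hsize {M₁ : Memory} (h : Preserves (forLoop k r p) M M₁) : M₁.reg r = N := by
    rw [h.reg_eq r (by simp [hregs, hrk, hrp]), hr]
  change Ensures y (.loop (.reg r ∸ .reg k) (p ;; .setReg k (.reg k ∔ .lit 1))) (M.setReg k 0) Q
  refine ensures_loop (fun M₁ qs => M₁.reg k ≤ N ∧ I (M₁.reg k) M₁ qs) (fun M₁ => N - M₁.reg k)
    (by omega) ⟨?_, ?_⟩ ?_ ?_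
  · simp [Memory.setReg_reg]
  · simpa [Memory.setReg_reg] using hI hinit
  · rintro M₁ qs hM₁ ⟨-, hI₁⟩ he
    simp only [Expr.eval, hsize (hpres hM₁)] at he
    simp only [Ensures, Expr.eval]
    refine (hstep _ (by omega) M₁ qs (hpres hM₁) rfl hI₁).mono fun M₂ qs' hM₂ hI₂ => ?_
    rw [List.append_nil, Memory.setReg_reg, if_pos rfl, hM₂.reg_eq k hkp]
    exact ⟨⟨by omega, hI hI₂⟩, by omega⟩
  · rintro M₁ qs hM₁ ⟨hle, hI₁⟩ he
    simp only [Expr.eval, hsize (hpres hM₁)] at he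
    obtain hk : M₁.reg k = N := by omega
    exact hpost M₁ qs (hpres hM₁) (hk ▸ hI₁)

/-- The constant part of the memory, after `fillResidues`. -/
structure Ready (n : ℕ) (M : Memory) : Prop where
  size_eq : M.reg Reg.size = n
  last_eq : M.reg Reg.last = n - 1
  residue_eq : ∀ i < 3 * n, M.arr Arr.residue i = i % n

theorem Preserves.ready (hp : Preserves p M M') (h : Ready n M)
    (hsize : Reg.size ∉ p.writtenRegs := by decide) (hlast : Reg.last ∉ p.writtenRegs := by decide)
    (hresidue : Arr.residue ∉ p.writtenArrs := by decide) : Ready n M' where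
  size_eq := (hp.reg_eq _ hsize).trans h.size_eq
  last_eq := (hp.reg_eq _ hlast).trans h.last_eq
  residue_eq i hi := by rw [hp.arr_eq _ hresidue, h.residue_eq i hi]

theorem ensures_fillResidues (h : M.reg Reg.size = n) :
    Ensures y fillResidues M fun M' qs => qs = [] ∧ Ready n M' := by
  simp only [fillResidues, Ensures, Expr.eval, h]
  refine ensures_forLoop (fun j M' qs => qs = [] ∧ ∀ i < j, M'.arr Arr.residue i = i ∧
    M'.arr Arr.residue (n + i) = i ∧ M'.arr Arr.residue (n + n + i) = i) h le_rfl (by simp) ?_ ?_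
  · rintro j hj M₁ _ hM₁ hi ⟨rfl, hres⟩
    have hsize : M₁.reg Reg.size = n := (hM₁.reg_eq Reg.size).trans h
    simp only [Ensures, Expr.eval, Memory.setArr_reg, Memory.setArr_arr, hi, hsize]
    refine ⟨rfl, fun i hi => ?_⟩
    grind
  · rintro M₁ _ hM₁ ⟨rfl, hres⟩
    refine ⟨rfl, (hM₁.reg_eq Reg.size).trans h, hM₁.reg_eq Reg.last, fun i hi => ?_⟩
    obtain ⟨k, t, ht, hk, rfl⟩ : ∃ k t, t < n ∧ k < 3 ∧ i = n * k + t :=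
      ⟨i / n, i % n, Nat.mod_lt _ (by omega), Nat.div_lt_of_lt_mul (by omega),
        (Nat.div_add_mod i n).symm⟩
    obtain ⟨h₀, h₁, h₂⟩ := hres t ht
    rw [Nat.mul_add_mod, Nat.mod_eq_of_lt ht]
    interval_cases k
    · simpa using h₀
    · simpa using h₁
    · simpa [mul_two] using h₂

/-- The memory when exactly the pegs of `y` at the positions in `S` are known. -/
structure Known (y : Equiv.Perm (Fin n)) (S : Finset (Fin n)) (M : Memory) : Prop
    extends Ready n M where
  unknown_eq : M.reg Reg.unknown + S.card = n
  peg_eq : ∀ i ∈ S, M.arr Arr.peg i = y i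
  known_eq : ∀ i : Fin n, M.arr Arr.known i = if i ∈ S then 1 else 0
  count_eq : ∀ d : Fin n, M.arr Arr.count d = diagCount y S d

variable {S : Finset (Fin n)}

theorem Preserves.known (hp : Preserves p M M') (h : Known y S M)
    (hsize : Reg.size ∉ p.writtenRegs := by decide) (hlast : Reg.last ∉ p.writtenRegs := by decide)
    (hresidue : Arr.residue ∉ p.writtenArrs := by decide)
    (hunknown : Reg.unknown ∉ p.writtenRegs := by decide)
    (hpeg : Arr.peg ∉ p.writtenArrs := by decide) (hknown : Arr.known ∉ p.writtenArrs := by decide)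
    (hcount : Arr.count ∉ p.writtenArrs := by decide) : Known y S M' where
  toReady := hp.ready h.toReady hsize hlast hresidue
  unknown_eq := by rw [hp.reg_eq _ hunknown, h.unknown_eq]
  peg_eq i hi := by rw [hp.arr_eq _ hpeg, h.peg_eq i hi]
  known_eq i := by rw [hp.arr_eq _ hknown, h.known_eq i]
  count_eq d := by rw [hp.arr_eq _ hcount, h.count_eq d]

theorem ensures_record (h : Known y S M) {i : Fin n} (hi : i ∉ S) (hpos : M.reg Reg.pos = i)
    (hcol : M.reg Reg.col = y i) :
    Ensures y record M fun M' qs => qs = [] ∧ Known y (insert i S) M' := by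
  have hcard : (insert i S).card = S.card + 1 := Finset.card_insert_of_notMem hi
  have hle : (insert i S).card ≤ n := by simpa using (insert i S).card_le_univ
  have hdiag : M.arr Arr.residue (n + i - y i) = diag y i := by
    rw [h.residue_eq _ (by omega), diag, Fin.val_sub]
    congr 1
    omega
  simp +decide only [record, Ensures, Expr.eval, Memory.setReg_reg, Memory.setReg_arr,
    Memory.setArr_reg, ↓reduceIte, hpos, hcol, h.size_eq, hdiag]
  refine ⟨rfl, ⟨h.size_eq, h.last_eq, fun k hk => ?_⟩, ?_, fun k hk => ?_, fun k => ?_,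
    fun k => ?_⟩
  · simpa +decide [Memory.setArr_arr, Memory.setReg_arr] using h.residue_eq k hk
  · simp +decide only [Memory.setArr_reg, Memory.setReg_reg, ↓reduceIte, hcard]
    have := h.unknown_eq
    omega
  · simp +decide only [Memory.setArr_arr, Memory.setReg_arr, ↓reduceIte, true_and, false_and,
      Fin.val_inj]
    split_ifs with hki
    · rw [hki]
    · exact h.peg_eq k (Finset.mem_of_mem_insert_of_ne hk hki)
  · simp +decide only [Memory.setArr_arr, Memory.setReg_arr, ↓reduceIte, true_and, false_and,
      Fin.val_inj, h.known_eq, Finset.mem_insert]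
    grind
  · simp +decide only [Memory.setArr_arr, Memory.setReg_arr, ↓reduceIte, true_and, false_and,
      Fin.val_inj, h.count_eq, diagCount_insert y hi]
    split_ifs with hk
    · rw [hk]
    · rfl

theorem ensures_tally (h : Known y S M) {x : Equiv.Perm (Fin n)}
    (hx : ∀ i : Fin n, M.arr Arr.guess i = x i) :
    Ensures y tally M fun M' qs => qs = [] ∧ M'.reg Reg.hits = knownBlack y x S := by
  simp only [tally, Ensures, Expr.eval]
  refine ensures_forLoop (fun j M' qs => qs = [] ∧ M'.reg Reg.hits +
    ∑ i ∈ Finset.univ.filter fun i : Fin n => j ≤ i, (if i ∈ S ∧ x i = y i then 1 else 0) =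
      knownBlack y x S) h.size_eq le_rfl ⟨rfl, ?_⟩ ?_ ?_
  · simp [Memory.setReg_reg, knownBlack, Finset.filter_and, Finset.inter_filter]
  · rintro j hj M₁ _ hM₁ hi ⟨rfl, hhits⟩
    have h₁ : Known y S M₁ := hM₁.known { h with }
    lift j to Fin n using hj
    have hguess : M₁.arr Arr.guess j = x j := by rw [hM₁.arr_eq Arr.guess]; exact hx j
    rw [sum_filter_le_val, ← add_assoc] at hhits
    simp +decide only [Ensures, Expr.eval, hi, h₁.known_eq, hguess, Memory.setReg_reg, ↓reduceIte]
    by_cases hjS : j ∈ S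
    · simp only [hjS, ↓reduceIte, one_ne_zero, h₁.peg_eq j hjS, true_and] at hhits ⊢
      have heq : (y j : ℕ) - x j + (x j - y j) = 0 ↔ x j = y j := by omega
      split_ifs <;> simp_all
    · simpa [hjS] using hhits
  · rintro M₁ _ - ⟨rfl, hhits⟩
    exact ⟨rfl, by simpa [fun i : Fin n => i.2.not_ge] using hhits⟩

variable [NeZero n] {d q m : Fin n}

theorem Ready.eval_positionAt (h : Ready n M) {t : Fin n} {e : Expr} (hd : M.reg Reg.d = d)
    (hq : M.reg Reg.q = q) (ht : e.eval M = t) :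
    (positionAt e).eval M = (q + d + 1 + t : Fin n) := by
  simp only [positionAt, Expr.eval, hd, hq, ht]
  rw [h.residue_eq _ (by omega)]
  simp [Fin.val_add]

theorem ensures_writeHybrid (h : Ready n M) (hd : M.reg Reg.d = d) (hq : M.reg Reg.q = q)
    (hm : M.reg Reg.m = m) : Ensures y writeHybrid M fun M' qs =>
      qs = [] ∧ ∀ i : Fin n, M'.arr Arr.guess i = hybrid d q m i := by
  refine ensures_forLoop (fun j M' qs => qs = [] ∧ ∀ t : Fin n, t < j →
    M'.arr Arr.guess (q + d + 1 + t : Fin n) = hybrid d q m (q + d + 1 + t)) h.size_eq le_rfl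
    (by simp) ?_ ?_
  · rintro j hj M₁ _ hM₁ hi ⟨rfl, hguess⟩
    have h₁ : Ready n M₁ := hM₁.ready h
    have hd₁ : M₁.reg Reg.d = d := (hM₁.reg_eq _).trans hd
    have hq₁ : M₁.reg Reg.q = q := (hM₁.reg_eq _).trans hq
    have hm₁ : M₁.reg Reg.m = m := (hM₁.reg_eq _).trans hm
    lift j to Fin n using hj
    have hwrite {v : ℕ} (hv : v = hybrid d q m (q + d + 1 + j)) :
        ∀ t : Fin n, (t : ℕ) < j + 1 → (M₁.setArr Arr.guess (q + d + 1 + j : Fin n) v).arr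
          Arr.guess (q + d + 1 + t : Fin n) = hybrid d q m (q + d + 1 + t) := by
      intro t ht
      rw [Memory.setArr_arr]
      split_ifs with heq
      · rw [hv, Fin.ext heq.2]
      · refine hguess t (lt_of_le_of_ne (Nat.lt_succ_iff.1 ht) fun htj => heq ⟨rfl, ?_⟩)
        rw [Fin.ext htj]
    have hpos : (positionAt (.reg Reg.i)).eval M₁ = (q + d + 1 + j : Fin n) :=
      h₁.eval_positionAt hd₁ hq₁ hi
    have hcol₁ : M₁.arr Arr.residue (q + 1 + j) = (q + 1 + j : Fin n) := by
      rw [h₁.residue_eq _ (by omega)]; simp [Fin.val_add]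
    have hcol₂ : M₁.arr Arr.residue (q + j) = (q + j : Fin n) := by
      rw [h₁.residue_eq _ (by omega)]; simp [Fin.val_add]
    simp only [Ensures, Expr.eval, hpos, hq₁, hm₁, hi, hcol₁, hcol₂]
    rw [hybrid_apply_add] at hwrite
    split_ifs with him hmi
    · exact ⟨rfl, hwrite (by grind)⟩
    · exact ⟨rfl, hwrite (by grind)⟩
    · exact ⟨rfl, hwrite (by grind)⟩
  · rintro M₁ _ - ⟨rfl, hguess⟩
    refine ⟨rfl, fun i => ?_⟩
    simpa only [add_offset] using hguess (offset d q i) (offset d q i).2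

theorem ensures_ask (h : Ready n M) (hd : M.reg Reg.d = d) (hq : M.reg Reg.q = q)
    (hm : M.reg Reg.m = m) : Ensures y ask M fun M' qs =>
      qs = [hybrid d q m] ∧ M'.reg Reg.answer = black (hybrid d q m) y ∧
        ∀ i : Fin n, M'.arr Arr.guess i = hybrid d q m i := by
  rw [ask, Ensures]
  refine (ensures_writeHybrid h hd hq hm).mono ?_
  rintro M₁ _ - ⟨rfl, hguess⟩
  exact ⟨hybrid d q m, hguess, rfl, rfl, hguess⟩

theorem ensures_findGap (h : Known y S M) : Ensures y findGap M fun M' qs => qs = [] ∧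
    ((M'.reg Reg.d = n ∧ ∀ d, ¬Gap y S d) ∨ ∃ d : Fin n, M'.reg Reg.d = d ∧ Gap y S d) := by
  simp only [findGap, Ensures, Expr.eval]
  refine ensures_forLoop (fun j M' qs => qs = [] ∧
    ((M'.reg Reg.d = n ∧ ∀ d : Fin n, d < j → ¬Gap y S d) ∨
      ∃ d : Fin n, M'.reg Reg.d = d ∧ Gap y S d)) h.size_eq le_rfl
    (by simp [Memory.setReg_reg, h.size_eq]) ?_ ?_
  · rintro j hj M₁ _ hM₁ hj₁ ⟨rfl, hd⟩
    have h₁ : Known y S M₁ := hM₁.known { h with }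
    lift j to Fin n using hj
    have hnext : M₁.arr Arr.residue (j + 1) = (j + 1 : Fin n) := by
      rw [h₁.residue_eq _ (by omega)]; simp [Fin.val_add]
    simp only [Ensures, Expr.eval, hj₁, hnext, h₁.count_eq, Memory.setReg_reg]
    have hcase (hj : ¬Gap y S j) (h : ∀ d : Fin n, d < j → ¬Gap y S d) (d : Fin n)
        (hdj : (d : ℕ) < j + 1) : ¬Gap y S d := by
      obtain rfl | hlt := (Fin.le_def.2 (Nat.lt_succ_iff.1 hdj)).eq_or_lt
      exacts [hj, h d hlt]
    split_ifs with h₀ h₁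
    · exact ⟨rfl, hd.imp_left (.imp_right (hcase fun hgap => hgap.1 h₀))⟩
    · exact ⟨rfl, .inr ⟨j, rfl, h₀, h₁⟩⟩
    · exact ⟨rfl, hd.imp_left (.imp_right (hcase fun hgap => h₁ hgap.2))⟩
  · rintro M₁ _ - ⟨rfl, hd⟩
    exact ⟨rfl, hd.imp_left fun hd => ⟨hd.1, fun d => hd.2 d d.2⟩⟩

theorem ensures_findGap_of_nonempty (h : Known y S M) (hS : S.Nonempty) (hS' : ∃ i, i ∉ S) :
    Ensures y findGap M fun M' qs => qs = [] ∧ ∃ d : Fin n, M'.reg Reg.d = d ∧ Gap y S d := by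
  refine (ensures_findGap h).mono ?_
  rintro M₁ _ - ⟨rfl, hd⟩
  exact ⟨rfl, hd.resolve_left fun hnone =>
    not_exists.2 hnone.2 (exists_gap y hS' (exists_diagCount_eq_zero y hS))⟩

theorem ensures_countShifts (h : Ready n M) (hknown : M.arr Arr.known = 0) :
    Ensures y countShifts M fun M' qs =>
      qs = (List.range (n - 1)).map (cyclicShift n) ∧ Known y ∅ M' := by
  have hn : 0 < n := Nat.pos_of_neZero n
  simp +decide only [countShifts, Ensures, Expr.eval, Memory.setReg_reg, ↓reduceIte, h.last_eq,
    h.size_eq]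
  refine ensures_forLoop (fun j M' qs => qs = (List.range j).map (cyclicShift n) ∧
    (∀ d : Fin n, d < j → M'.arr Arr.count d = diagCount y ∅ d) ∧
    M'.arr Arr.count (n - 1) =
      ∑ d ∈ Finset.univ.filter fun d : Fin n => j ≤ d, diagCount y ∅ d) h.last_eq (by omega)
    ⟨rfl, by simp, by simp [Memory.setArr_arr, sum_diagCount]⟩ ?_ ?_
  · rintro j hj M₁ _ hM₁ hdj ⟨rfl, hcount, hsum⟩
    have h₁ : Ready n M₁ := hM₁.ready { h with }
    lift j to Fin n using by omega
    simp only [Ensures, Expr.eval]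
    refine (ensures_ask (q := 0) (m := ⟨n - 1, by omega⟩) h₁ hdj
      ((hM₁.reg_eq Reg.q).trans (Fin.val_zero n).symm) (hM₁.reg_eq Reg.m)).mono ?_
    rintro M₂ _ hM₂ ⟨rfl, hans, -⟩
    rw [hybrid_last_eq_cyclicShift (Nat.sub_add_cancel hn)] at hans ⊢
    rw [black_cyclicShift] at hans
    simp only [Memory.setArr_reg, Memory.setArr_arr, hans, hM₂.reg_eq Reg.d, hdj,
      hM₂.reg_eq Reg.last, hM₂.arr_eq Arr.count, h₁.last_eq, true_and]
    refine ⟨by simp [List.range_succ], fun d hd => ?_, ?_⟩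
    · rw [if_neg (by omega)]
      split_ifs with hdj'
      · rw [Fin.ext hdj']
      · exact hcount d (by omega)
    · rw [if_pos trivial, if_neg hj.ne', hsum, sum_filter_le_val, Nat.add_sub_cancel_left]
  · rintro M₁ _ hM₁ ⟨rfl, hcount, hsum⟩
    refine ⟨rfl, hM₁.ready { h with }, ?_, by simp, fun i => ?_, fun d => ?_⟩
    · exact hM₁.reg_eq Reg.unknown
    · simp [hM₁.arr_eq Arr.known, Memory.setArr_arr, Memory.setReg_arr, hknown]
    · obtain hd | hd : (d : ℕ) < n - 1 ∨ (d : ℕ) = n - 1 := by omega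
      · exact hcount d hd
      · rw [hd, hsum]
        refine Finset.sum_eq_single_of_mem d (Finset.mem_filter.2 ⟨Finset.mem_univ d, hd.ge⟩) ?_
        intro i hi hid
        exact absurd (Fin.ext (by have := (Finset.mem_filter.1 hi).2; omega)) hid

theorem ensures_scanHybrids (h : Ready n M) (hd : M.reg Reg.d = d)
    (hgap : diagCount y ∅ (d + 1) = 0) : Ensures y scanHybrids M fun M' qs =>
      qs.length ≤ n - 1 ∧ ∃ i, M'.reg Reg.pos = (i : Fin n) ∧ M'.reg Reg.col = y i := by
  set s := offset d 0 (y.symm 0) with hs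
  simp only [scanHybrids, Ensures, Expr.eval]
  refine ensures_forLoop (fun j M' qs => qs.length = j ∧
    M'.reg Reg.lo = (if (s : ℕ) < j then s else n - 1 : ℕ) ∧
    ∀ m : Fin n, m = j → M'.reg Reg.previous = black (hybrid d 0 m) y) h.last_eq (by omega)
    ⟨rfl, h.last_eq, fun m hm => ?_⟩ ?_ ?_
  · rw [Fin.ext (hm.trans (Fin.val_zero n).symm), black_hybrid_zero y hgap]
    rfl
  · rintro j hj M₁ qs hM₁ hj₁ ⟨hlen, hlo, hprev⟩
    have h₁ : Ready n M₁ := hM₁.ready { h with }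
    have hd₁ : M₁.reg Reg.d = d := (hM₁.reg_eq Reg.d).trans hd
    have hq₁ : M₁.reg Reg.q = (0 : Fin n) := (hM₁.reg_eq Reg.q).trans (Fin.val_zero n).symm
    obtain ⟨m, hm⟩ : ∃ m : Fin n, (m : ℕ) = j + 1 := ⟨⟨j + 1, by omega⟩, rfl⟩
    lift j to Fin n using by omega
    have hlt := black_hybrid_succ_lt_iff y hgap (q := 0) hm
    rw [← hs, ← tsub_pos_iff_lt, Fin.ext_iff] at hlt
    simp only [Ensures, Expr.eval, hj₁]
    refine (ensures_ask (M := M₁.setReg Reg.m (j + 1)) { h₁ with } hd₁ hq₁ hm.symm).mono ?_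
    rintro M₂ _ hM₂ ⟨rfl, hans, -⟩
    have hprev₂ : M₂.reg Reg.previous = black (hybrid d 0 j) y :=
      (hM₂.reg_eq Reg.previous).trans (hprev j rfl)
    have hlo₂ : M₂.reg Reg.lo = _ := (hM₂.reg_eq Reg.lo).trans hlo
    have hj₂ : M₂.reg Reg.j = j := (hM₂.reg_eq Reg.j).trans hj₁
    simp +decide only [Memory.setReg_reg, ↓reduceIte, hans, hprev₂, hlo₂, hj₂]
    split <;> exact ⟨by simp [hlen], by split_ifs <;> omega,
      fun m' hm' => by rw [Fin.ext (hm.trans hm'.symm)]⟩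
  · rintro M₁ qs hM₁ ⟨hlen, hlo, -⟩
    have h₁ : Ready n M₁ := hM₁.ready { h with }
    have hlo₁ : (Expr.reg Reg.lo).eval M₁ = s := hlo.trans (by split_ifs <;> omega)
    refine ⟨by simpa using hlen.le, y.symm 0, ?_, by simp [Memory.setReg_reg]⟩
    simp +decide only [Memory.setReg_reg, ↓reduceIte]
    rw [h₁.eval_positionAt (d := d) (q := 0) ((hM₁.reg_eq Reg.d).trans hd)
      ((hM₁.reg_eq Reg.q).trans (Fin.val_zero n).symm) hlo₁, hs, add_offset]

theorem ensures_askSwap (h : Ready n M) {k : Fin n} (hd : M.reg Reg.d = 0) (hq : M.reg Reg.q = 0)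
    (hm : M.reg Reg.m = n - 1) (hk : M.reg Reg.j + 1 = k) : Ensures y askSwap M fun M' qs =>
      qs = [Equiv.swap 0 k] ∧ M'.reg Reg.answer = black (Equiv.swap 0 k) y := by
  have hn : n - 1 < n := by have := NeZero.pos n; omega
  rw [askSwap, Ensures]
  refine (ensures_writeHybrid (d := 0) (q := 0) (m := ⟨n - 1, hn⟩) h
    (hd.trans (Fin.val_zero n).symm) (hq.trans (Fin.val_zero n).symm) hm).mono ?_
  rintro M₁ _ hM₁ ⟨rfl, hguess⟩
  rw [hybrid_last_eq_cyclicShift (Nat.sub_add_cancel (NeZero.pos n))] at hguess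
  simp only [cyclicShift_apply, sub_zero] at hguess
  simp only [Ensures, Expr.eval, Memory.setArr_reg, hM₁.reg_eq Reg.j, hk]
  refine ⟨Equiv.swap 0 k, fun i => ?_, rfl, rfl⟩
  simp only [Memory.setArr_arr, hguess, true_and, Equiv.swap_apply_def, Fin.ext_iff, Fin.val_zero]
  split_ifs <;> simp_all

theorem diagCount_empty_zero_ne_one (y : Equiv.Perm (Fin 2)) : diagCount y ∅ 0 ≠ 1 := by
  revert y
  decide

theorem ensures_scanSwaps (h : Ready n M) (h1 : diagCount y ∅ 0 = 1) :
    Ensures y scanSwaps M fun M' qs =>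
      qs.length ≤ n - 1 ∧ ∃ i, M'.reg Reg.pos = (i : Fin n) ∧ M'.reg Reg.col = y i := by
  have hn : n ≠ 2 := by
    rintro rfl
    exact diagCount_empty_zero_ne_one y h1
  obtain ⟨e, -, he⟩ := (diagCount_ne_zero_iff y).1 (h1.trans_ne one_ne_zero)
  rw [diag_eq_iff, sub_zero] at he
  simp only [scanSwaps, Ensures, Expr.eval]
  refine ensures_forLoop (fun j M' qs => qs.length = j ∧ ((e : ℕ) = 0 → M'.reg Reg.zeros = j) ∧
    ((e : ℕ) ≠ 0 → M'.reg Reg.zeros = (if (e : ℕ) < j + 1 then 1 else 0) ∧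
      ((e : ℕ) < j + 1 → M'.reg Reg.pos = e))) h.last_eq (by omega) ?_ ?_ ?_
  · simp only [Memory.setReg_reg]
    simp +contextual
  · rintro j hj M₁ qs hM₁ hj₁ ⟨hlen, h0, hpos⟩
    have h₁ : Ready n M₁ := hM₁.ready { h with }
    obtain ⟨k, hk⟩ : ∃ k : Fin n, (k : ℕ) = j + 1 := ⟨⟨j + 1, by omega⟩, rfl⟩
    have hzero := black_swap_eq_zero_iff y h1 he (k := 0) (l := k) (by simp [Fin.ext_iff, hk])
    rw [Fin.ext_iff, Fin.ext_iff, Fin.val_zero, hk] at hzero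
    rw [Ensures]
    refine (ensures_askSwap (k := k) h₁ (hM₁.reg_eq Reg.d) (hM₁.reg_eq Reg.q)
      ((hM₁.reg_eq Reg.m).trans h.last_eq) (by rw [hj₁, hk])).mono ?_
    rintro M₂ _ hM₂ ⟨rfl, hans⟩
    simp +decide only [Ensures, Expr.eval, hans, hM₂.reg_eq Reg.zeros, hM₂.reg_eq Reg.j, hj₁,
      hM₂.reg_eq Reg.pos, Memory.setReg_reg, ↓reduceIte, hzero]
    simp only [List.length_append, List.length_singleton, List.length_nil, hlen]
    split_ifs <;> grind
  · rintro M₁ qs hM₁ ⟨hlen, h0, hpos⟩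
    have hlast : M₁.reg Reg.last = n - 1 := (hM₁.reg_eq Reg.last).trans h.last_eq
    have he' : (e : ℕ) < n - 1 + 1 := by omega
    simp +decide only [Memory.setReg_reg, ↓reduceIte, hlast, tsub_eq_zero_iff_le]
    split_ifs with hzeros
    · refine ⟨by simpa using hlen.le, e, ?_⟩
      have he0 : (e : ℕ) = 0 := by grind
      simp [he, he0]
    · refine ⟨by simpa using hlen.le, e, ?_⟩
      rw [he, (hpos fun he0 => hzeros (h0 he0).ge).2 he']
      exact ⟨rfl, rfl⟩

theorem ensures_findFirst (h : Known y ∅ M) : Ensures y findFirst M fun M' qs =>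
    qs.length ≤ n - 1 ∧ ∃ i, Known y {i} M' ∧ M'.reg Reg.q = y i := by
  rw [findFirst, Ensures]
  refine (ensures_findGap h).mono ?_
  rintro M₁ _ hM₁ ⟨rfl, hd⟩
  have h₁ : Known y ∅ M₁ := hM₁.known h
  have hscan : Ensures y (.ite (.reg Reg.size ∸ .reg Reg.d) scanHybrids scanSwaps) M₁ fun M' qs =>
      qs.length ≤ n - 1 ∧ ∃ i, M'.reg Reg.pos = (i : Fin n) ∧ M'.reg Reg.col = y i := by
    simp only [Ensures, Expr.eval, h₁.size_eq]
    obtain ⟨hd, hgap⟩ | ⟨d, hd, hgap⟩ := hd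
    · rw [hd, if_pos (Nat.sub_self n)]
      refine ensures_scanSwaps h₁.toReady (diagCount_empty_eq_one y (fun d hzero => ?_) 0)
      exact absurd (exists_gap y ⟨0, Finset.notMem_empty 0⟩ ⟨d, hzero⟩) (not_exists.2 hgap)
    · rw [hd, if_neg (Nat.sub_ne_zero_of_lt d.2)]
      exact ensures_scanHybrids h₁.toReady hd hgap.2
  rw [Ensures]
  refine hscan.mono ?_
  rintro M₂ qs hM₂ ⟨hlen, i, hpos, hcol⟩
  simp only [Ensures, Expr.eval]
  refine (ensures_record (M := M₂.setReg Reg.q (M₂.reg Reg.col)) { hM₂.known h₁ with }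
    (Finset.notMem_empty i) hpos hcol).mono ?_
  rintro M₃ _ hM₃ ⟨rfl, h₃⟩
  exact ⟨by simpa using hlen, i, by simpa using h₃, (hM₃.reg_eq Reg.q).trans hcol⟩

theorem ensures_probe (h : Known y S M) (hd : M.reg Reg.d = d) (hq : M.reg Reg.q = q)
    (hm : M.reg Reg.m = m) : Ensures y probe M fun M' qs =>
      qs.length = 1 ∧ M'.reg Reg.answer = black (hybrid d q m) y ∧
        M'.reg Reg.hits = knownBlack y (hybrid d q m) S := by
  rw [probe, Ensures]
  refine (ensures_ask h.toReady hd hq hm).mono ?_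
  rintro M₁ _ hM₁ ⟨rfl, hans, hguess⟩
  refine (ensures_tally (hM₁.known h) hguess).mono ?_
  rintro M₂ _ hM₂ ⟨rfl, hhits⟩
  exact ⟨rfl, (hM₂.reg_eq Reg.answer).trans hans, hhits⟩

theorem ensures_bisect (h : Known y S M) {p : Fin n} (hp : p ∈ S) (hd : M.reg Reg.d = d)
    (hq : M.reg Reg.q = y p) (hgap : Gap y S d) (hlo : M.reg Reg.lo = 0)
    (hhi : M.reg Reg.hi = n - 1) : Ensures y bisect M fun M' qs =>
      qs.length ≤ Nat.clog 2 (n - 1) ∧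
        ∃ i ∉ S, diag y i = d ∧ M'.reg Reg.lo = offset d (y p) i := by
  obtain ⟨i, hi, hdi, hblack⟩ := hgap.exists_knownBlack_lt_black_iff y hp
  have hlast := offset_add_one_lt y hp hi hdi
  refine ensures_loop (fun M' qs =>
    qs.length + Nat.clog 2 (M'.reg Reg.hi - M'.reg Reg.lo) ≤ Nat.clog 2 (n - 1) ∧
    M'.reg Reg.lo ≤ offset d (y p) i ∧ offset d (y p) i < M'.reg Reg.hi ∧ M'.reg Reg.hi < n)
    (fun M' => M'.reg Reg.hi - M'.reg Reg.lo) (by omega) ?_ ?_ ?_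
  · simp only [hlo, hhi, List.length_nil, Nat.sub_zero, zero_add, le_refl, true_and]
    omega
  · rintro M₁ qs hM₁ ⟨hlen, hlo₁, hhi₁, hhin⟩ hlt
    have h₁ : Known y S M₁ := hM₁.known h
    simp only [Expr.eval] at hlt
    obtain ⟨m, hm⟩ : ∃ m : Fin n, (m : ℕ) = (M₁.reg Reg.lo + M₁.reg Reg.hi) / 2 :=
      ⟨⟨_, by omega⟩, rfl⟩
    simp only [Ensures, Expr.eval, ← hm]
    refine (ensures_probe (M := M₁.setReg Reg.m m) { h₁ with } ((hM₁.reg_eq Reg.d).trans hd)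
      ((hM₁.reg_eq Reg.q).trans hq) rfl).mono ?_
    rintro M₂ qs' hM₂ ⟨hlen', hans, hhits⟩
    have hlo₂ : M₂.reg Reg.lo = M₁.reg Reg.lo := hM₂.reg_eq Reg.lo
    have hhi₂ : M₂.reg Reg.hi = M₁.reg Reg.hi := hM₂.reg_eq Reg.hi
    have hm₂ : M₂.reg Reg.m = m := hM₂.reg_eq Reg.m
    have hsearch := hblack m
    rw [← hhits, ← hans, ← tsub_pos_iff_lt] at hsearch
    have hleft := clog_two_add_one_le (w := M₁.reg Reg.hi - M₁.reg Reg.lo)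
      (k := m - M₁.reg Reg.lo) (by omega) (by omega)
    have hright := clog_two_add_one_le (w := M₁.reg Reg.hi - M₁.reg Reg.lo)
      (k := M₁.reg Reg.hi - m) (by omega) (by omega)
    simp +decide only [Memory.setReg_reg, ↓reduceIte, hlo₂, hhi₂, hm₂, List.length_append,
      List.length_nil, hlen']
    split_ifs <;> omega
  · rintro M₁ qs - ⟨hlen, hlo₁, hhi₁, -⟩ heq
    simp only [Expr.eval] at heq
    exact ⟨by omega, i, hi, hdi, by omega⟩

theorem ensures_findNext (h : Known y S M) {p : Fin n} (hp : p ∈ S) (hq : M.reg Reg.q = y p)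
    (hS : ∃ i, i ∉ S) : Ensures y findNext M fun M' qs => qs.length ≤ Nat.clog 2 (n - 1) ∧
      ∃ i ∉ S, Known y (insert i S) M' := by
  rw [findNext, Ensures]
  refine (ensures_findGap_of_nonempty h ⟨p, hp⟩ hS).mono ?_
  rintro M₁ _ hM₁ ⟨rfl, d, hd, hgap⟩
  have h₁ : Known y S M₁ := hM₁.known h
  have hq₁ : M₁.reg Reg.q = y p := (hM₁.reg_eq Reg.q).trans hq
  simp only [Ensures, Expr.eval]
  refine (ensures_bisect (d := d) (p := p) (M := (M₁.setReg Reg.lo 0).setReg Reg.hi _) { h₁ with }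
    hp hd hq₁ hgap rfl h₁.last_eq).mono ?_
  rintro M₂ qs hM₂ ⟨hlen, i, hi, hdi, hlo⟩
  have h₂ : Known y S M₂ := hM₂.known { h₁ with }
  have hq₂ : M₂.reg Reg.q = y p := (hM₂.reg_eq Reg.q).trans hq₁
  have hpos := h₂.eval_positionAt (e := .reg Reg.lo) ((hM₂.reg_eq Reg.d).trans hd) hq₂ hlo
  rw [add_offset] at hpos
  have hcol : M₂.arr Arr.residue (M₂.reg Reg.q + M₂.reg Reg.lo + 1) = y i := by
    rw [hq₂, hlo, h₂.residue_eq _ (by omega), apply_of_diag_eq y (q := y p) hdi]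
    simp [Fin.val_add]
  refine (ensures_record (M := (M₂.setReg Reg.pos _).setReg Reg.col _) { h₂ with } hi hpos
    hcol).mono ?_
  rintro M₃ _ - ⟨rfl, h₃⟩
  exact ⟨by simpa using hlen, i, hi, h₃⟩

theorem ensures_findRest {i : Fin n} (h : Known y {i} M) (hq : M.reg Reg.q = y i) :
    Ensures y findRest M fun M' qs => qs.length ≤ (n - 2) * Nat.clog 2 (n - 1) ∧
      ∃ S, S.Nonempty ∧ Sᶜ.card ≤ 1 ∧ Known y S M' := by
  have hunknown : M.reg Reg.unknown + 1 = n := h.unknown_eq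
  refine ensures_loop (fun M' qs => (∃ S, i ∈ S ∧ Known y S M') ∧ qs.length +
    (M'.reg Reg.unknown - 1) * Nat.clog 2 (n - 1) ≤ (n - 2) * Nat.clog 2 (n - 1))
    (fun M' => M'.reg Reg.unknown) (by omega)
    ⟨⟨{i}, Finset.mem_singleton_self i, h⟩, ?_⟩ ?_ ?_
  · simp [← hunknown]
  · rintro M₁ qs hM₁ ⟨⟨S, hi, h₁⟩, hlen⟩ hmany
    have hcard := h₁.unknown_eq
    simp only [Expr.eval] at hmany
    have hS : ∃ j, j ∉ S := by
      by_contra! hall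
      rw [Finset.eq_univ_of_forall hall, Finset.card_fin] at hcard
      omega
    refine (ensures_findNext h₁ hi ((hM₁.reg_eq Reg.q).trans hq) hS).mono ?_
    rintro M₂ qs' - ⟨hlen', j, hj, h₂⟩
    have hcard' := h₂.unknown_eq
    rw [Finset.card_insert_of_notMem hj] at hcard'
    refine ⟨⟨⟨_, Finset.mem_insert_of_mem hi, h₂⟩, ?_⟩, by omega⟩
    obtain ⟨k, hk⟩ : ∃ k, M₂.reg Reg.unknown = k + 1 :=
      Nat.exists_eq_add_of_le' (by omega)
    have hk' : M₁.reg Reg.unknown = k + 2 := by omega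
    rw [hk', Nat.add_succ_sub_one, Nat.add_one_mul] at hlen
    rw [List.length_append, hk, Nat.add_sub_cancel]
    omega
  · rintro M₁ qs - ⟨⟨S, hi, h₁⟩, hlen⟩ hfew
    simp only [Expr.eval] at hfew
    have hcard := h₁.unknown_eq
    have hcompl : Sᶜ.card ≤ 1 := by
      rw [Finset.card_compl, Fintype.card_fin]
      omega
    exact ⟨(Nat.le_add_right _ _).trans hlen, S, ⟨i, hi⟩, hcompl, h₁⟩

theorem ensures_finish (h : Known y S M) (hS : S.Nonempty) (hcard : Sᶜ.card ≤ 1) :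
    Ensures y finish M fun M' qs => qs = [y] ∧ ∀ i : Fin n, M'.arr Arr.peg i = y i := by
  rw [finish, Ensures]
  refine (ensures_findGap h).mono ?_
  rintro M₁ _ hM₁ ⟨rfl, hd⟩
  have hdiag (i : Fin n) (hi : i ∉ S) : M₁.reg Reg.d = diag y i := by
    obtain ⟨d, hd, hgap⟩ := hd.resolve_left fun hnone =>
      not_exists.2 hnone.2 (exists_gap y ⟨i, hi⟩ (exists_diagCount_eq_zero y hS))
    rw [hd, hgap.diag_eq y hcard hi]
  rw [Ensures]
  refine ensures_forLoop (fun j M' qs => qs = [] ∧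
    ∀ i : Fin n, i ∈ S ∨ i < j → M'.arr Arr.peg i = y i) (hM₁.known h).size_eq le_rfl
    ⟨rfl, by simpa using (hM₁.known h).peg_eq⟩ ?_ ?_
  · rintro j hj M₂ _ hM₂ hi ⟨rfl, hpeg⟩
    have h₂ : Ready n M₂ := hM₂.ready (hM₁.ready h.toReady)
    have hknown : M₂.arr Arr.known j = if (⟨j, hj⟩ : Fin n) ∈ S then 1 else 0 := by
      rw [hM₂.arr_eq Arr.known]
      exact (hM₁.known h).known_eq ⟨j, hj⟩
    lift j to Fin n using hj
    have hlt (i : Fin n) : (i : ℕ) < j + 1 ↔ (i : ℕ) < j ∨ i = j := by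
      rw [Nat.lt_succ_iff_lt_or_eq, Fin.ext_iff]
    simp only [Ensures, Expr.eval, hi, hknown, h₂.size_eq, hM₂.reg_eq Reg.d, Memory.setArr_arr,
      true_and, Fin.val_inj, hlt]
    by_cases hjS : j ∈ S
    · rw [if_pos hjS, if_neg one_ne_zero]
      exact ⟨rfl, fun i hi => hpeg i (by grind)⟩
    · rw [if_neg hjS, if_pos rfl]
      refine ⟨rfl, fun i hi => ?_⟩
      split_ifs with hij
      · rw [hij, hdiag j hjS, h₂.residue_eq _ (by omega), (diag_eq_iff y).1 rfl, Fin.val_sub]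
        congr 1
        omega
      · exact hpeg i (by grind)
  · rintro M₂ _ - ⟨rfl, hpeg⟩
    have hpeg' : ∀ i : Fin n, M₂.arr Arr.peg i = y i := fun i => hpeg i (.inr i.2)
    exact ⟨y, hpeg', rfl, hpeg'⟩

theorem ensures_strategy (y : Equiv.Perm (Fin n)) :
    Ensures y strategy (Memory.init n) fun M' qs =>
      (List.range (n - 1)).map (cyclicShift n) <+: qs ∧ qs.getLast? = some y ∧
      (∀ i : Fin n, M'.arr Arr.peg i = y i) ∧
      qs.length ≤ 2 * (n - 1) + (n - 2) * Nat.clog 2 (n - 1) + 1 := by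
  rw [strategy, Ensures]
  refine (ensures_fillResidues (n := n) (M := Memory.init n) rfl).mono ?_
  rintro M₁ _ hM₁ ⟨rfl, h₁⟩
  rw [Ensures]
  refine (ensures_countShifts h₁ (hM₁.arr_eq Arr.known)).mono ?_
  rintro M₂ _ - ⟨rfl, h₂⟩
  rw [Ensures]
  refine (ensures_findFirst h₂).mono ?_
  rintro M₃ qs₃ - ⟨hlen₃, i, h₃, hq⟩
  rw [Ensures]
  refine (ensures_findRest h₃ hq).mono ?_
  rintro M₄ qs₄ - ⟨hlen₄, S, hS, hcard, h₄⟩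
  refine (ensures_finish h₄ hS hcard).mono ?_
  rintro M₅ _ - ⟨rfl, hpeg⟩
  refine ⟨List.prefix_append _ _, by simp [← List.append_assoc], hpeg, ?_⟩
  simp only [List.nil_append, List.length_append, List.length_map, List.length_range,
    List.length_singleton]
  omega

end Correctness

theorem two_mul_clog_two_le {n : ℕ} (hn : 6 ≤ n) : 2 * Nat.clog 2 n ≤ n := by
  have hpow (k : ℕ) : 2 * (k + 3) + 1 ≤ 2 ^ (k + 3) := by
    induction k with
    | zero => norm_num
    | succ k ih => rw [add_right_comm, pow_succ]; omega
  have hle : n ≤ 2 ^ (n / 2) := by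
    have := hpow (n / 2 - 3)
    rw [Nat.sub_add_cancel (by omega)] at this
    omega
  have := Nat.clog_le_of_le_pow hle
  omega

theorem query_bound {n : ℕ} (hn : 1 ≤ n) :
    ((2 * (n - 1) + (n - 2) * Nat.clog 2 (n - 1) + 1 : ℕ) : ℝ) ≤
      ((n : ℝ) - 3) * (Nat.clog 2 n : ℝ) + 5 / 2 * (n : ℝ) - 1 := by
  obtain hsmall | hlarge := lt_or_ge n 6
  · interval_cases n <;> simp [Nat.clog_of_two_le] <;> norm_num
  · have hlog : (2 * Nat.clog 2 n : ℝ) ≤ n := by exact_mod_cast two_mul_clog_two_le hlarge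
    have hmono : ((n : ℝ) - 2) * Nat.clog 2 (n - 1) ≤ (n - 2) * Nat.clog 2 n := by
      have : (6 : ℝ) ≤ n := by exact_mod_cast hlarge
      gcongr
      · linarith
      · exact Nat.sub_le n 1
    push_cast [Nat.cast_sub hn, Nat.cast_sub (show 2 ≤ n by omega)]
    linarith

end Mastermind

theorem mainTheorem1 :
    ∃ (p : Mastermind.Program) (T : Polynomial ℕ),
      ∀ (n : ℕ), 1 ≤ n → ∀ y : Equiv.Perm (Fin n),
        ∃ (M : Mastermind.Memory) (t : ℕ) (qs : List (Equiv.Perm (Fin n))),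
          Mastermind.Run y p (Mastermind.Memory.init n) M t qs ∧
          t ≤ T.eval n ∧
          (List.range (n - 1)).map (Mastermind.cyclicShift n) <+: qs ∧
          qs.getLast? = some y ∧
          (∀ i : Fin n, M.arr 0 (i : ℕ) = (y i : ℕ)) ∧
          (qs.length : ℝ) ≤
            ((n : ℝ) - 3) * (⌈Real.logb 2 (n : ℝ)⌉ : ℝ) + 5 / 2 * (n : ℝ) - 1 := by
  refine ⟨Mastermind.strategy, Mastermind.strategy.time, fun n hn y => ?_⟩
  have : NeZero n := ⟨Nat.one_le_iff_ne_zero.1 hn⟩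
  obtain ⟨M, t, qs, hrun, ht, hpre, hlast, hpeg, hlen⟩ := (Mastermind.ensures_strategy y).exists_run
  refine ⟨M, t, qs, hrun, ht, hpre, hlast, hpeg, ?_⟩
  have hlog : ⌈Real.logb 2 (n : ℝ)⌉ = (Nat.clog 2 n : ℤ) := by
    exact_mod_cast Real.ceil_logb_natCast (b := 2) (Nat.cast_nonneg n)
  rw [hlog, Int.cast_natCast]
  exact (Nat.cast_le.2 hlen).trans (Mastermind.query_bound hn)
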